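/- Let $M$ be a smooth 3-manifold (possibly with boundary), let $\xi=\ker\alpha$ be a cooriented contact structure on $M$, where $\alpha$ is a smooth 1-form with $\alpha\wedge d\alpha\neq 0$ everywhere, and let $c:M\to M$ be a real structure for which $\xi$ is real: a smooth involution with $c_*\xi=-\xi$ as cooriented plane fields (for instance $c^*\alpha=-\alpha$). Let $S\subset M$ be a connected oriented smoothly embedded surface (closed or not, possibly with boundary) that is convex for $\xi$, i.e. there is a contact vector field $Y$ (a smooth vector field with $\mathcal L_Y\alpha=\mu\alpha$ for some function $\mu$) defined on an open neighbourhood of $S$ in $M$ and transverse to $S$. Call $S$ symmetric (respectively antisymmetric) if $c(S)=S$ and $c|_S$ preserves (respectively reverses) the orientation of $S$. (1) If $S$ is symmetric, then there are an open neighbourhood $U$ of $S$ with $c(U)=U$ and a contact vector field $X$ for $\xi$ on $U$ which is transverse to $S$ and symmetric, i.e. $c_*X=X$ on $U$. (2) If $S$ is antisymmetric, then there are an open neighbourhood $U$ of $S$ with $c(U)=U$ and a contact vector field $X$ for $\xi$ on $U$ which is transverse to $S$ and antisymmetric, i.e. $c_*X=-X$ on $U$. In both cases the dividing set of $S$ determined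 by $X$, namely $\Gamma=\{p\in S : X_p\in\xi_p\}$, is $c$-invariant: $c(\Gamma)=\Gamma$. In particular $S$ has an invariant dividing set. -/

import Mathlib

open Set Topology
open scoped Manifold ContDiff Bundle

noncomputable section

namespace RealContact

section Ambient

variable {E : Type*} [NormedAddCommGroup E] [NormedSpace ℝ E]
  {H : Type*} [TopologicalSpace H] (I : ModelWithCorners ℝ E H)
  {M : Type*} [TopologicalSpace M] [ChartedSpace H M]

/-- Smoothness of a 1-form `α` on `M`, as a section of the cotangent bundle. -/
def IsSmoothOneForm [IsManifold I ∞ M] (α : ∀ p : M, TangentSpace I p →L[ℝ] ℝ) : Prop :=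
  ContMDiff I (I.prod 𝓘(ℝ, E →L[ℝ] ℝ)) ∞ fun p ↦
    Bundle.TotalSpace.mk' (E →L[ℝ] ℝ)
      (E := fun p : M ↦ TangentSpace I p →L[ℝ] Bundle.Trivial M ℝ p) p (α p)

/-- The 1-form `α` written in the chart `φ` of `M` around `p`: the pullback `(φ⁻¹)^* α`,
as a differential 1-form on (the image of the chart in) the model space. -/
def chartForm (α : ∀ p : M, TangentSpace I p →L[ℝ] ℝ) (p : M) (x : E) : E [⋀^Fin 1]→L[ℝ] ℝ :=
  ContinuousAlternatingMap.ofSubsingleton ℝ E ℝ (0 : Fin 1)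
    ((α ((extChartAt I p).symm x)).comp
      (mfderivWithin 𝓘(ℝ, E) I (extChartAt I p).symm (range I) x))

/-- The exterior derivative `dα` of a 1-form `α`, at `p`, evaluated on `u, v ∈ T_p M`:
pass to the chart `φ` around `p`, apply the exterior derivative of the model space there, and
pull back by `dφ_p`. (At points of `∂M` the derivative is taken within the range of the model.) -/
def dForm (α : ∀ p : M, TangentSpace I p →L[ℝ] ℝ) (p : M) (u v : TangentSpace I p) : ℝ :=
  extDerivWithin (chartForm I α p) (range I) (extChartAt I p p)
    ![mfderiv I 𝓘(ℝ, E) (extChartAt I p) p u, mfderiv I 𝓘(ℝ, E) (extChartAt I p) p v]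

/-- `α` is a contact form on the 3-manifold `M`: it is smooth and the 3-form `α ∧ dα` vanishes
nowhere. The cooriented contact structure `ξ` is `ker α`, with positive side `α > 0`. -/
structure IsContactForm [IsManifold I ∞ M] (α : ∀ p : M, TangentSpace I p →L[ℝ] ℝ) : Prop where
  smooth : IsSmoothOneForm I α
  wedge_ne_zero : ∀ p : M, ∃ u v w : TangentSpace I p,
    α p u * dForm I α p v w + α p v * dForm I α p w u + α p w * dForm I α p u v ≠ 0

/-- `c` is a real structure on `M` for which the cooriented contact structure `ξ = ker α` is real:
`c` is a smooth involution and `c_* ξ = -ξ`, i.e. `dc` exchanges the positive and the negative side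
of `ξ` (and hence maps `ξ` to `ξ`). This holds for instance if `c^* α = -α`. -/
structure IsRealStructure (α : ∀ p : M, TangentSpace I p →L[ℝ] ℝ) (c : M → M) : Prop where
  smooth : ContMDiff I I ∞ c
  involutive : Function.Involutive c
  anti : ∀ (p : M) (v : TangentSpace I p), 0 < α p v ↔ α (c p) (mfderiv I I c p v) < 0

/-- The Lie derivative `(L_Y α)_p (v) = dα_p (Y_p, v) + d(α(Y))_p (v)`. -/
def lieDerivForm (Y : ∀ p : M, TangentSpace I p) (α : ∀ p : M, TangentSpace I p →L[ℝ] ℝ)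
    (p : M) (v : TangentSpace I p) : ℝ :=
  dForm I α p (Y p) v + (show ℝ from mfderiv I 𝓘(ℝ, ℝ) (fun q : M ↦ α q (Y q)) p v)

/-- `Y` is, on the open set `U`, a (smooth) contact vector field for `ξ = ker α`:
`L_Y α = μ α` on `U` for some function `μ` (which is then automatically smooth). -/
structure IsContactVectorFieldOn [IsManifold I ∞ M]
    (α : ∀ p : M, TangentSpace I p →L[ℝ] ℝ)
    (Y : ∀ p : M, TangentSpace I p) (U : Set M) : Prop where
  isOpen : IsOpen U
  smooth : ContMDiffOn I I.tangent ∞ (fun p ↦ (⟨p, Y p⟩ : TangentBundle I M)) U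
  contact : ∃ μ : M → ℝ, ∀ p ∈ U, ∀ v : TangentSpace I p,
    lieDerivForm I Y α p v = μ p * α p v

/-- The vector field `X` is symmetric on `U`: `c(U) = U` and `c_* X = X` on `U`. -/
def IsSymmetricFieldOn (c : M → M) (X : ∀ p : M, TangentSpace I p) (U : Set M) : Prop :=
  c '' U = U ∧ ∀ p ∈ U, mfderiv I I c p (X p) = X (c p)

/-- The vector field `X` is antisymmetric on `U`: `c(U) = U` and `c_* X = -X` on `U`. -/
def IsAntisymmetricFieldOn (c : M → M) (X : ∀ p : M, TangentSpace I p) (U : Set M) : Prop :=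
  c '' U = U ∧ ∀ p ∈ U, mfderiv I I c p (X p) = -X (c p)

end Ambient

section Surface

variable {F : Type*} [NormedAddCommGroup F] [NormedSpace ℝ F]
  {G : Type*} [TopologicalSpace G] (J : ModelWithCorners ℝ F G)
  {N : Type*} [TopologicalSpace N] [ChartedSpace G N]

/-- `(a, b)` is a basis of the tangent plane `T_x N` in the orientation `o` of that plane. -/
def IsPositiveFrame {x : N} (o : Orientation ℝ (TangentSpace J x) (Fin 2))
    (a b : TangentSpace J x) : Prop :=
  ∃ B : Module.Basis (Fin 2) ℝ (TangentSpace J x), B.orientation = o ∧ B 0 = a ∧ B 1 = b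

/-- An orientation of the surface `N`: an orientation of each tangent plane such that around every
point there is a continuous local frame which is positive at each point. -/
structure SurfaceOrientation [IsManifold J ∞ N] where
  orient : ∀ x : N, Orientation ℝ (TangentSpace J x) (Fin 2)
  continuous : ∀ x₀ : N, ∃ V ∈ 𝓝 x₀, ∃ a b : ∀ x : N, TangentSpace J x,
    ContinuousOn (fun x ↦ (⟨x, a x⟩ : TangentBundle J N)) V ∧
    ContinuousOn (fun x ↦ (⟨x, b x⟩ : TangentBundle J N)) V ∧
    ∀ x ∈ V, IsPositiveFrame J (orient x) (a x) (b x)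

variable {E : Type*} [NormedAddCommGroup E] [NormedSpace ℝ E]
  {H : Type*} [TopologicalSpace H] (I : ModelWithCorners ℝ E H)
  {M : Type*} [TopologicalSpace M] [ChartedSpace H M]

/-- The oriented surface `S = ι(N)` is symmetric: `c(S) = S`, and `c|_S` preserves the orientation,
i.e. `dc` carries positive frames of `T_p S` to positive frames of `T_{c(p)} S`. -/
def IsSymmetricSurface [IsManifold J ∞ N] (o : SurfaceOrientation J (N := N)) (ι : N → M)
    (c : M → M) : Prop :=
  c '' range ι = range ι ∧
  ∀ x y : N, c (ι x) = ι y → ∀ a b : TangentSpace J x, IsPositiveFrame J (o.orient x) a b →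
    ∃ a' b' : TangentSpace J y, IsPositiveFrame J (o.orient y) a' b' ∧
      tangentMap I I c (tangentMap J I ι ⟨x, a⟩) = tangentMap J I ι ⟨y, a'⟩ ∧
      tangentMap I I c (tangentMap J I ι ⟨x, b⟩) = tangentMap J I ι ⟨y, b'⟩

/-- The oriented surface `S = ι(N)` is antisymmetric: `c(S) = S`, and `c|_S` reverses the
orientation, i.e. `dc` carries positive frames of `T_p S` to negative frames of `T_{c(p)} S`
(those which become positive when the two vectors are exchanged). -/
def IsAntisymmetricSurface [IsManifold J ∞ N] (o : SurfaceOrientation J (N := N)) (ι : N → M)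
    (c : M → M) : Prop :=
  c '' range ι = range ι ∧
  ∀ x y : N, c (ι x) = ι y → ∀ a b : TangentSpace J x, IsPositiveFrame J (o.orient x) a b →
    ∃ a' b' : TangentSpace J y, IsPositiveFrame J (o.orient y) b' a' ∧
      tangentMap I I c (tangentMap J I ι ⟨x, a⟩) = tangentMap J I ι ⟨y, a'⟩ ∧
      tangentMap I I c (tangentMap J I ι ⟨x, b⟩) = tangentMap J I ι ⟨y, b'⟩

/-- The vector field `X` is transverse to the surface `S = ι(N)` in the 3-manifold `M`: at no point
of `S` is it tangent to `S`. -/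
def IsTransverse (ι : N → M) (X : ∀ p : M, TangentSpace I p) : Prop :=
  ∀ x : N, X (ι x) ∉ range (mfderiv J I ι x)

/-- `X` is a contact vector field for `ξ = ker α` on the neighbourhood `U` of `S = ι(N)`, and it is
transverse to `S`. -/
def IsTransverseContactField [IsManifold I ∞ M]
    (α : ∀ p : M, TangentSpace I p →L[ℝ] ℝ) (ι : N → M)
    (X : ∀ p : M, TangentSpace I p) (U : Set M) : Prop :=
  range ι ⊆ U ∧ IsContactVectorFieldOn I α X U ∧ IsTransverse J I ι X

/-- The surface `S = ι(N)` is convex for `ξ = ker α`: some contact vector field defined near `S` is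
transverse to `S`. -/
def IsConvexSurface [IsManifold I ∞ M]
    (α : ∀ p : M, TangentSpace I p →L[ℝ] ℝ) (ι : N → M) : Prop :=
  ∃ (U : Set M) (Y : ∀ p : M, TangentSpace I p), IsTransverseContactField J I α ι Y U

/-- The set of points of `S = ι(N)` at which `X` is tangent to `ξ = ker α`. -/
def tangencySet (α : ∀ p : M, TangentSpace I p →L[ℝ] ℝ) (ι : N → M)
    (X : ∀ p : M, TangentSpace I p) : Set M :=
  {p | p ∈ range ι ∧ α p (X p) = 0}

/-- `Γ` is a dividing set of the convex surface `S = ι(N)`: for some contact vector field `X` near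
`S` and transverse to `S`, it is the set of points of `S` at which `X` is tangent to `ξ`. -/
def IsDividingSet [IsManifold I ∞ M]
    (α : ∀ p : M, TangentSpace I p →L[ℝ] ℝ) (ι : N → M) (Γ : Set M) : Prop :=
  ∃ (U : Set M) (X : ∀ p : M, TangentSpace I p),
    IsTransverseContactField J I α ι X U ∧ Γ = tangencySet I α ι X

end Surface

end RealContact

end

/-! Let `ε = 1` if `c` preserves the orientation of `S` and `ε = -1` if it reverses it. Given a
transverse contact field `Y`, the required field is the average `X = Y + ε c_*Y` on `U ∩ c⁻¹(U)`.
Since `c` is an involution and `ε² = 1`, `c_*X = εX` is immediate (`map_add_pushforward`), and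
invariance of the dividing set follows because `dc` preserves `ξ`.

`X` is contact: reality of `ξ` means `c^*α = kα` with `k` nowhere zero
(`IsRealStructure.exists_factor`), so `c_*Y` is again contact (`lieDerivForm_pushforward`), and
contact fields form a vector space.

`X` is transverse: a sum of transverse fields may become tangent, unless both point to the same side
of `S`. Sides are measured by `α ∧ dα`: contracted with `Y` and restricted to `S` it is a nowhere
zero area form, of constant sign because `S` is connected (`exists_side`). Moreover `c^*(α ∧ dα) =
k² α ∧ dα` (`contactVolume_pullback`), so `c` preserves the orientation of `M`, whatever the sign of
`k`. Hence `c_*Y` lies on the side of `Y` exactly when `c|_S` preserves orientation, so `Y` and `ε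
c_*Y` always lie on the same side. -/

noncomputable section

namespace RealContact

/-! ### Exterior derivative of a 1-form in charts, and its behaviour under pullback. -/

section ChartCalculus

variable {E : Type*} [NormedAddCommGroup E] [NormedSpace ℝ E]
  {H : Type*} [TopologicalSpace H] {I : ModelWithCorners ℝ E H}
  {M : Type*} [TopologicalSpace M] [ChartedSpace H M]

/-- The covector `α z`, as a linear form on the model space. -/
def covector (α : ∀ p : M, TangentSpace I p →L[ℝ] ℝ) (z : M) : E →L[ℝ] ℝ := α z

/-- The derivative at `z` of the chart around `p`, as a map of the model space. -/
def chartDeriv (I : ModelWithCorners ℝ E H) (p z : M) : E →L[ℝ] E :=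
  mfderiv I 𝓘(ℝ, E) (extChartAt I p) z

/-- The derivative at `z` of a self-map of `M`, as a map of the model space. -/
def selfDeriv (I : ModelWithCorners ℝ E H) (g : M → M) (z : M) : E →L[ℝ] E :=
  mfderiv I I g z

/-- The derivative at `x` of the inverse of the chart around `p`, as a map of the model space. -/
def chartSymmDeriv (I : ModelWithCorners ℝ E H) (p : M) (x : E) : E →L[ℝ] E :=
  mfderivWithin 𝓘(ℝ, E) I (extChartAt I p).symm (range I) x

theorem chartSymmDeriv_comp_chartDeriv [IsManifold I ∞ M] {p z : M}
    (hz : z ∈ (extChartAt I p).source) (v : E) :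
    chartSymmDeriv I p (extChartAt I p z) (chartDeriv I p z v) = v :=
  DFunLike.congr_fun (mfderivWithin_extChartAt_symm_comp_mfderiv_extChartAt' (I := I) hz) v

theorem chartForm_extChartAt_apply (α : ∀ p : M, TangentSpace I p →L[ℝ] ℝ) {p z : M}
    (hz : z ∈ (extChartAt I p).source) (u : Fin 1 → E) :
    chartForm I α p (extChartAt I p z) u =
      covector α z (chartSymmDeriv I p (extChartAt I p z) (u 0)) := by
  -- The fibre depends on the base point, so the base point is generalised and then substituted;
  -- rewriting it in place would be ill-typed.
  have key : ∀ (z' : M) (w : E), z' = z → covector α z' w = covector α z w := by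
    rintro _ _ rfl; rfl
  exact key _ _ ((extChartAt I p).left_inv hz)

theorem chartForm_chartDeriv_apply [IsManifold I ∞ M] (α : ∀ p : M, TangentSpace I p →L[ℝ] ℝ)
    {p z : M} (hz : z ∈ (extChartAt I p).source) (u : Fin 1 → E) :
    chartForm I α p (extChartAt I p z) (fun i ↦ chartDeriv I p z (u i)) = covector α z (u 0) := by
  rw [chartForm_extChartAt_apply α hz, chartSymmDeriv_comp_chartDeriv hz]

/-- The cotangent trivialization at `p` precomposes a covector with the derivative of the inverse
chart. The form in the chart is therefore the fibre coordinate of the smooth section `α`, up to the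
isometry between covectors and alternating 1-forms. -/
theorem contDiffWithinAt_chartForm [IsManifold I ∞ M]
    {α : ∀ p : M, TangentSpace I p →L[ℝ] ℝ}
    (hα : IsSmoothOneForm I α) {p z : M} (hz : z ∈ (extChartAt I p).source) :
    ContDiffWithinAt ℝ ∞ (chartForm I α p) (range I) (extChartAt I p z) := by
  have hz' : z ∈ (chartAt H p).source := by simpa using hz
  have h1 := hα z
  rw [Bundle.Trivialization.contMDiffAt_iff
    (e := trivializationAt (E →L[ℝ] ℝ)
      (fun p : M ↦ TangentSpace I p →L[ℝ] Bundle.Trivial M ℝ p) p) (by simpa using hz')] at h1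
  have h2 := h1.2
  rw [contMDiffAt_iff_of_mem_source hz' (mem_chart_source _ _)] at h2
  have h3 := h2.2
  have h4 := (ContinuousAlternatingMap.ofSubsingletonLIE (𝕜 := ℝ) (E := E) (F := ℝ)
    (0 : Fin 1)).contDiff.comp_contDiffWithinAt h3
  have hEq : ∀ x ∈ (extChartAt I p).source, chartForm I α p (extChartAt I p x) =
      ContinuousAlternatingMap.ofSubsingletonLIE (𝕜 := ℝ) (E := E) (F := ℝ) (0 : Fin 1)
        (trivializationAt (E →L[ℝ] ℝ)
          (fun p : M ↦ TangentSpace I p →L[ℝ] Bundle.Trivial M ℝ p) p ⟨x, α x⟩).2 := by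
    intro x hx
    ext u
    have hx' : x ∈ (chartAt H p).source := by simpa using hx
    have hsymm : chartSymmDeriv I p (extChartAt I p x) =
        ((trivializationAt E (TangentSpace I) p).symmL ℝ x : E →L[ℝ] E) :=
      (TangentBundle.symmL_trivializationAt (I := I) hx').symm
    rw [chartForm_extChartAt_apply α hx, hsymm]
    change _ = ((trivializationAt ℝ (Bundle.Trivial M ℝ) p).continuousLinearMapAt ℝ x)
      (α x ((trivializationAt E (TangentSpace I) p).symmL ℝ x (u 0)))
    exact (DFunLike.congr_fun (Bundle.Trivial.continuousLinearMapAt_trivialization ℝ M ℝ x)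
      _).symm
  refine h4.congr_of_eventuallyEq_of_mem ?_ (by simp)
  filter_upwards [extChartAt_target_mem_nhdsWithin_of_mem
    ((extChartAt I p).map_source hz)] with y hy
  have := hEq _ ((extChartAt I p).map_target hy)
  rw [(extChartAt I p).right_inv hy] at this
  exact this

/-- The exterior derivative of `α` at `x`, computed in the chart around `p`. -/
def dFormAt (I : ModelWithCorners ℝ E H) (α : ∀ p : M, TangentSpace I p →L[ℝ] ℝ)
    (p x : M) (u v : E) : ℝ :=
  extDerivWithin (chartForm I α p) (range I) (extChartAt I p x)
    ![chartDeriv I p x u, chartDeriv I p x v]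

theorem dFormAt_add_left (α : ∀ p : M, TangentSpace I p →L[ℝ] ℝ) (p x : M) (u u' v : E) :
    dFormAt I α p x (u + u') v = dFormAt I α p x u v + dFormAt I α p x u' v := by
  rw [dFormAt, map_add]
  exact (extDerivWithin _ _ _).toAlternatingMap.map_vecCons_add _ _ _

theorem dFormAt_smul_left (α : ∀ p : M, TangentSpace I p →L[ℝ] ℝ) (p x : M) (t : ℝ) (u v : E) :
    dFormAt I α p x (t • u) v = t * dFormAt I α p x u v := by
  rw [dFormAt, map_smul]
  exact (extDerivWithin _ _ _).toAlternatingMap.map_vecCons_smul _ _ _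

theorem dFormAt_swap (α : ∀ p : M, TangentSpace I p →L[ℝ] ℝ) (p x : M) (u v : E) :
    dFormAt I α p x v u = -dFormAt I α p x u v := by
  have := (extDerivWithin (chartForm I α p) (range I) (extChartAt I p x)).map_swap
    ![chartDeriv I p x u, chartDeriv I p x v] (i := 0) (j := 1) (by simp)
  rw [dFormAt, dFormAt]
  refine Eq.trans ?_ this
  change extDerivWithin _ _ _ _ = extDerivWithin _ _ _ _
  congr 1
  ext i; fin_cases i <;> simp

theorem extDerivWithin_one_apply {A : E → E [⋀^Fin 1]→L[ℝ] ℝ} {s : Set E} {x : E}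
    (u v : E) : extDerivWithin A s x ![u, v] =
      fderivWithin ℝ A s x u ![v] - fderivWithin ℝ A s x v ![u] := by
  simp [extDerivWithin, ContinuousAlternatingMap.alternatizeUncurryFin_apply]
  rw [← sub_eq_add_neg]
  congr 2
  ext i; fin_cases i; rfl

/-- Evaluated on a vector `w` with `A x w ≠ 0`, the factor `k` is the quotient of `B y w` by `A y w`
near `x`. -/
theorem differentiableWithinAt_of_eventuallyEq_smul {A B : E → E [⋀^Fin 1]→L[ℝ] ℝ} {k : E → ℝ}
    {s : Set E} {x : E} (hA : DifferentiableWithinAt ℝ A s x)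
    (hB : DifferentiableWithinAt ℝ B s x) (hx : x ∈ s) (hAx : A x ≠ 0)
    (h : ∀ᶠ y in 𝓝[s] x, B y = k y • A y) : DifferentiableWithinAt ℝ k s x := by
  obtain ⟨w, hw⟩ : ∃ w, A x w ≠ 0 := by
    by_contra! h; exact hAx (by ext w; exact h w)
  have hA' : DifferentiableWithinAt ℝ (fun y ↦ A y w) s x :=
    hA.continuousAlternatingMap_apply_const w
  have hB' : DifferentiableWithinAt ℝ (fun y ↦ B y w) s x :=
    hB.continuousAlternatingMap_apply_const w
  refine DifferentiableWithinAt.congr_of_eventuallyEq_of_mem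
    (f := fun y ↦ B y w * (A y w)⁻¹) (hB'.mul (hA'.inv hw)) ?_ hx
  filter_upwards [h, hA'.continuousWithinAt.eventually_ne hw] with y hy hy'
  rw [hy, ContinuousAlternatingMap.smul_apply, smul_eq_mul, mul_assoc, mul_inv_cancel₀ hy',
    mul_one]

/-- The Leibniz rule `d(kA) = dk ∧ A + k dA`. -/
theorem extDerivWithin_eventuallyEq_smul {A B : E → E [⋀^Fin 1]→L[ℝ] ℝ} {k : E → ℝ}
    {s : Set E} {x : E} (hA : DifferentiableWithinAt ℝ A s x)
    (hk : DifferentiableWithinAt ℝ k s x) (hs : UniqueDiffWithinAt ℝ s x) (hx : x ∈ s)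
    (h : ∀ᶠ y in 𝓝[s] x, B y = k y • A y) (u v : E) :
    extDerivWithin B s x ![u, v] = fderivWithin ℝ k s x u * A x ![v] -
      fderivWithin ℝ k s x v * A x ![u] + k x * extDerivWithin A s x ![u, v] := by
  have h' : B =ᶠ[𝓝[s] x] fun y ↦ k y • A y := h
  rw [h'.extDerivWithin_eq_of_mem hx, extDerivWithin_one_apply,
    extDerivWithin_one_apply, fderivWithin_fun_smul hs hk hA]
  simp; ring

theorem fderivWithin_writtenInCharts [IsManifold I ∞ M] {g : M → M} {p q z : M}
    (hg : MDifferentiableAt I I g z) (hz : z ∈ (extChartAt I p).source)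
    (hgz : g z ∈ (extChartAt I q).source) :
    fderivWithin ℝ (extChartAt I q ∘ g ∘ (extChartAt I p).symm) (range I) (extChartAt I p z) =
      chartDeriv I q (g z) ∘L selfDeriv I g z ∘L chartSymmDeriv I p (extChartAt I p z) := by
  have hl := (extChartAt I p).left_inv hz
  have h1 := (mdifferentiableWithinAt_extChartAt_symm (I := I)
    ((extChartAt I p).map_source hz)).hasMFDerivWithinAt
  rw [← hl] at hg hgz
  have h3 := (mdifferentiableAt_extChartAt (I := I) (x := q)
    (y := g ((extChartAt I p).symm (extChartAt I p z)))
    (by simpa using hgz)).hasMFDerivAt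
  have h4 := HasMFDerivAt.comp_hasMFDerivWithinAt (f := g ∘ (extChartAt I p).symm)
    (s := range I) (extChartAt I p z) h3
    (HasMFDerivAt.comp_hasMFDerivWithinAt (f := (extChartAt I p).symm) (s := range I)
      (extChartAt I p z) hg.hasMFDerivAt h1)
  have h5 : HasFDerivWithinAt (extChartAt I q ∘ g ∘ (extChartAt I p).symm)
      (chartDeriv I q (g ((extChartAt I p).symm (extChartAt I p z))) ∘L
        selfDeriv I g ((extChartAt I p).symm (extChartAt I p z)) ∘L
        chartSymmDeriv I p (extChartAt I p z)) (range I) (extChartAt I p z) :=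
    HasMFDerivWithinAt.hasFDerivWithinAt h4
  have key : ∀ z' : M, z' = z →
      chartDeriv I q (g z') ∘L selfDeriv I g z' ∘L chartSymmDeriv I p (extChartAt I p z) =
      chartDeriv I q (g z) ∘L selfDeriv I g z ∘L chartSymmDeriv I p (extChartAt I p z) := by
    rintro _ rfl; rfl
  have h6 := h5.fderivWithin (I.uniqueDiffOn _ (extChartAt_target_subset_range p
    ((extChartAt I p).map_source hz)))
  exact h6.trans (key _ hl)

/-- If `g^* α = k α`, then in charts the pullback of `α` by `g` is a multiple of `α`. -/
theorem chartForm_pullback [IsManifold I ∞ M] {α : ∀ p : M, TangentSpace I p →L[ℝ] ℝ}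
    {g : M → M} {k : M → ℝ} {p q z : M}
    (hg : MDifferentiableAt I I g z) (hz : z ∈ (extChartAt I p).source)
    (hgz : g z ∈ (extChartAt I q).source)
    (hk : ∀ w : E, covector α (g z) (selfDeriv I g z w) = k z * covector α z w) :
    (chartForm I α q ((extChartAt I q ∘ g ∘ (extChartAt I p).symm)
        (extChartAt I p z))).compContinuousLinearMap
      (fderivWithin ℝ (extChartAt I q ∘ g ∘ (extChartAt I p).symm) (range I)
        (extChartAt I p z)) = k z • chartForm I α p (extChartAt I p z) := by
  ext u
  rw [fderivWithin_writtenInCharts hg hz hgz]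
  simp only [Function.comp_apply, ContinuousAlternatingMap.compContinuousLinearMap_apply,
    (extChartAt I p).left_inv hz, ContinuousAlternatingMap.smul_apply, smul_eq_mul]
  rw [chartForm_extChartAt_apply α hz, ← hk]
  exact chartForm_chartDeriv_apply α hgz
    (fun i ↦ selfDeriv I g z (chartSymmDeriv I p (extChartAt I p z) (u i)))

theorem differentiableWithinAt_chartForm [IsManifold I ∞ M]
    {α : ∀ p : M, TangentSpace I p →L[ℝ] ℝ}
    (hα : IsSmoothOneForm I α) {p z : M} (hz : z ∈ (extChartAt I p).source) :
    DifferentiableWithinAt ℝ (chartForm I α p) (range I) (extChartAt I p z) :=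
  (contDiffWithinAt_chartForm hα hz).differentiableWithinAt (by simp)

theorem contDiffWithinAt_writtenInCharts [IsManifold I ∞ M] {g : M → M}
    (hg : ContMDiff I I ∞ g) {p q z : M} (hz : z ∈ (extChartAt I p).source)
    (hgz : g z ∈ (extChartAt I q).source) :
    ContDiffWithinAt ℝ ∞ (extChartAt I q ∘ g ∘ (extChartAt I p).symm) (range I)
      (extChartAt I p z) :=
  ((contMDiffAt_iff_of_mem_source (by simpa using hz) (by simpa using hgz)).1 (hg z)).2

theorem eventually_chartForm_pullback [IsManifold I ∞ M]
    {α : ∀ p : M, TangentSpace I p →L[ℝ] ℝ}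
    {g : M → M} (hg : ContMDiff I I ∞ g) {k : M → ℝ}
    (hk : ∀ (z : M) (w : E), covector α (g z) (selfDeriv I g z w) = k z * covector α z w)
    {p q z : M} (hz : z ∈ (extChartAt I p).source) (hgz : g z ∈ (extChartAt I q).source) :
    ∀ᶠ y in 𝓝[range I] (extChartAt I p z),
      (chartForm I α q ((extChartAt I q ∘ g ∘ (extChartAt I p).symm) y)).compContinuousLinearMap
        (fderivWithin ℝ (extChartAt I q ∘ g ∘ (extChartAt I p).symm) (range I) y) =
      k ((extChartAt I p).symm y) • chartForm I α p y := by
  have hs : ∀ᶠ x in 𝓝 z, g x ∈ (extChartAt I q).source :=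
    hg.continuous.continuousAt.eventually ((isOpen_extChartAt_source q).mem_nhds hgz)
  have hs' : ∀ᶠ y in 𝓝[range I] (extChartAt I p z),
      g ((extChartAt I p).symm y) ∈ (extChartAt I q).source := by
    have h := continuousAt_extChartAt_symm' hz
    rw [ContinuousAt, (extChartAt I p).left_inv hz] at h
    exact (h.eventually hs).filter_mono nhdsWithin_le_nhds
  filter_upwards [hs', extChartAt_target_mem_nhdsWithin_of_mem
    ((extChartAt I p).map_source hz)] with y hy hyt
  have := chartForm_pullback (hg.mdifferentiableAt (by simp))
    ((extChartAt I p).map_target hyt) hy (hk _)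
  rwa [(extChartAt I p).right_inv hyt] at this

/-- No regularity of a conformal factor enters here; this is what allows `mdifferentiableAt_factor`
to deduce that of `k`. -/
theorem differentiableWithinAt_pullback [IsManifold I ∞ M]
    {α : ∀ p : M, TangentSpace I p →L[ℝ] ℝ} (hα : IsSmoothOneForm I α)
    {g : M → M} (hg : ContMDiff I I ∞ g)
    {p q z : M} (hz : z ∈ (extChartAt I p).source) (hgz : g z ∈ (extChartAt I q).source) :
    DifferentiableWithinAt ℝ (fun y ↦
      (chartForm I α q ((extChartAt I q ∘ g ∘ (extChartAt I p).symm) y)).compContinuousLinearMap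
        (fderivWithin ℝ (extChartAt I q ∘ g ∘ (extChartAt I p).symm) (range I) y))
      (range I) (extChartAt I p z) := by
  have hx : extChartAt I p z ∈ range I := extChartAt_target_subset_range p
    ((extChartAt I p).map_source hz)
  have hf := contDiffWithinAt_writtenInCharts hg hz hgz
  refine DifferentiableWithinAt.continuousAlternatingMapCompContinuousLinearMap ?_ ?_
  · refine DifferentiableWithinAt.comp (g := chartForm I α q)
      (f := extChartAt I q ∘ g ∘ (extChartAt I p).symm) (t := range I) _ ?_
      (hf.differentiableWithinAt (by simp)) ?_
    · simp only [Function.comp_apply, (extChartAt I p).left_inv hz]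
      exact differentiableWithinAt_chartForm hα hgz
    · intro y _
      exact mem_range_self _
  · exact (hf.fderivWithin_right (m := 1) I.uniqueDiffOn (by norm_cast) hx).differentiableWithinAt
      one_ne_zero

/-- If `g^* α = k α` with `α` nonzero at `z`, then `k` is differentiable at `z`. -/
theorem mdifferentiableAt_factor [IsManifold I ∞ M]
    {α : ∀ p : M, TangentSpace I p →L[ℝ] ℝ} (hα : IsSmoothOneForm I α)
    {g : M → M} (hg : ContMDiff I I ∞ g) {k : M → ℝ}
    (hk : ∀ (z : M) (w : E), covector α (g z) (selfDeriv I g z w) = k z * covector α z w)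
    {z : M} (hne : covector α z ≠ 0) : MDifferentiableAt I 𝓘(ℝ, ℝ) k z := by
  have hz := mem_extChartAt_source (I := I) z
  have hgz := mem_extChartAt_source (I := I) (g z)
  have hx : extChartAt I z z ∈ range I := mem_range_self _
  rw [mdifferentiableAt_iff_source_of_mem_source (mem_chart_source H z)]
  refine DifferentiableWithinAt.mdifferentiableWithinAt ?_
  refine differentiableWithinAt_of_eventuallyEq_smul (differentiableWithinAt_chartForm hα hz)
    (differentiableWithinAt_pullback hα hg hz hgz) hx ?_
    (eventually_chartForm_pullback hg hk hz hgz)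
  intro h0
  apply hne
  ext w
  have := chartForm_chartDeriv_apply α hz (fun _ ↦ w)
  rw [h0] at this
  exact this.symm

/-- The exterior derivative of a form `α` with `g^* α = k α`. -/
theorem dFormAt_pullback [IsManifold I ∞ M]
    {α : ∀ p : M, TangentSpace I p →L[ℝ] ℝ} (hα : IsSmoothOneForm I α)
    {g : M → M} (hg : ContMDiff I I ∞ g) {k : M → ℝ}
    (hk : ∀ (z : M) (w : E), covector α (g z) (selfDeriv I g z w) = k z * covector α z w)
    {p q z : M} (hz : z ∈ (extChartAt I p).source) (hgz : g z ∈ (extChartAt I q).source)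
    {k' : E →L[ℝ] ℝ} (hk' : HasMFDerivAt I 𝓘(ℝ, ℝ) k z k') (u v : E) :
    dFormAt I α q (g z) (selfDeriv I g z u) (selfDeriv I g z v) =
      k' u * covector α z v - k' v * covector α z u + k z * dFormAt I α p z u v := by
  have hx : extChartAt I p z ∈ range I := extChartAt_target_subset_range p
    ((extChartAt I p).map_source hz)
  have hl := (extChartAt I p).left_inv hz
  have hs := I.uniqueDiffOn _ hx
  have hkφ : HasFDerivWithinAt (k ∘ (extChartAt I p).symm)
      (k' ∘L chartSymmDeriv I p (extChartAt I p z)) (range I) (extChartAt I p z) := by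
    have h1 := (mdifferentiableWithinAt_extChartAt_symm (I := I)
      ((extChartAt I p).map_source hz)).hasMFDerivWithinAt
    rw [← hl] at hk'
    exact HasMFDerivWithinAt.hasFDerivWithinAt
      (HasMFDerivAt.comp_hasMFDerivWithinAt (f := (extChartAt I p).symm) (s := range I)
      (extChartAt I p z) hk' h1)
  have hf := contDiffWithinAt_writtenInCharts hg hz hgz
  have hd : DifferentiableWithinAt ℝ (chartForm I α q) (range I)
      ((extChartAt I q ∘ g ∘ (extChartAt I p).symm) (extChartAt I p z)) := by
    simp only [Function.comp_apply, hl]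
    exact differentiableWithinAt_chartForm hα hgz
  -- `d` commutes with pullback. At boundary points this uses that the range of the model lies in
  -- the closure of its interior.
  have e1 := extDerivWithin_pullback (t := range I) (r := ∞)
    (f := extChartAt I q ∘ g ∘ (extChartAt I p).symm) (s := range I) (x := extChartAt I p z)
    hd hf (by simp [minSmoothness_of_isRCLikeNormedField]; norm_cast) I.uniqueDiffOn
    (I.range_subset_closure_interior hx) hx
    (fun y _ ↦ mem_range_self _)
  have e2 := extDerivWithin_eventuallyEq_smul (differentiableWithinAt_chartForm hα hz)
    hkφ.differentiableWithinAt hs hx (eventually_chartForm_pullback hg hk hz hgz)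
    (chartDeriv I p z u) (chartDeriv I p z v)
  rw [e1, fderivWithin_writtenInCharts (hg.mdifferentiableAt (by simp)) hz hgz,
    hkφ.fderivWithin hs] at e2
  have e3 : ∀ w : E, chartForm I α p (extChartAt I p z) ![chartDeriv I p z w] =
      covector α z w := by
    intro w
    refine Eq.trans ?_ (chartForm_chartDeriv_apply α hz ![w])
    congr 1
    ext i; fin_cases i; rfl
  simp only [ContinuousLinearMap.comp_apply, chartSymmDeriv_comp_chartDeriv hz, e3] at e2
  simp only [Function.comp_apply, hl, ContinuousAlternatingMap.compContinuousLinearMap_apply]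
    at e2
  rw [dFormAt, dFormAt, ← e2]
  congr 1
  ext i
  fin_cases i <;>
    simp [-extChartAt, chartSymmDeriv_comp_chartDeriv hz]

/-- Independence of the chart is the pullback formula for `g = id` and `k = 1`. -/
theorem dFormAt_eq_dFormAt [IsManifold I ∞ M]
    {α : ∀ p : M, TangentSpace I p →L[ℝ] ℝ} (hα : IsSmoothOneForm I α)
    {p q z : M} (hz : z ∈ (extChartAt I p).source) (hz' : z ∈ (extChartAt I q).source)
    (u v : E) : dFormAt I α q z u v = dFormAt I α p z u v := by
  have hid : ∀ (z : M) (w : E), selfDeriv I id z w = w := fun z w ↦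
    DFunLike.congr_fun (mfderiv_id (I := I) (x := z)) w
  have := dFormAt_pullback hα (contMDiff_id (I := I)) (k := fun _ ↦ 1) (by simp [hid]) hz hz'
    (hasMFDerivAt_const (1 : ℝ) z) u v
  simp only [hid, id] at this
  rw [this]
  change (0 : ℝ) * _ - 0 * _ + _ = _
  ring

end ChartCalculus

/-! ### The volume form `α ∧ dα`, the conformal factor of `c`, and pushforwards of contact fields.
-/

section ContactFields

variable {E : Type*} [NormedAddCommGroup E] [NormedSpace ℝ E]
  {H : Type*} [TopologicalSpace H] {I : ModelWithCorners ℝ E H}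
  {M : Type*} [TopologicalSpace M] [ChartedSpace H M]

/-- The 3-form `α ∧ dα` at `x`, with `dα` computed in the chart around `p`. -/
def contactVolume (I : ModelWithCorners ℝ E H) (α : ∀ p : M, TangentSpace I p →L[ℝ] ℝ)
    (p x : M) (u v w : E) : ℝ :=
  covector α x u * dFormAt I α p x v w + covector α x v * dFormAt I α p x w u +
    covector α x w * dFormAt I α p x u v

theorem dFormAt_add_right (α : ∀ p : M, TangentSpace I p →L[ℝ] ℝ) (p x : M) (u v v' : E) :
    dFormAt I α p x u (v + v') = dFormAt I α p x u v + dFormAt I α p x u v' := by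
  rw [dFormAt_swap α p x (v + v') u, dFormAt_add_left, dFormAt_swap α p x u v,
    dFormAt_swap α p x u v']
  ring

theorem dFormAt_smul_right (α : ∀ p : M, TangentSpace I p →L[ℝ] ℝ) (p x : M) (t : ℝ) (u v : E) :
    dFormAt I α p x u (t • v) = t * dFormAt I α p x u v := by
  rw [dFormAt_swap α p x (t • v) u, dFormAt_smul_left, dFormAt_swap α p x u v]
  ring

theorem dFormAt_self (α : ∀ p : M, TangentSpace I p →L[ℝ] ℝ) (p x : M) (u : E) :
    dFormAt I α p x u u = 0 := by
  have := dFormAt_swap α p x u u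
  linarith

/-- The 3-form `α ∧ dα` as an alternating map on the model space. -/
def contactVolumeMap (I : ModelWithCorners ℝ E H) (α : ∀ p : M, TangentSpace I p →L[ℝ] ℝ)
    (p x : M) : E [⋀^Fin 3]→ₗ[ℝ] ℝ where
  toFun m := contactVolume I α p x (m 0) (m 1) (m 2)
  map_update_add' m i u v := by
    -- The field quantifies over all decidability instances on `Fin 3`; the canonical one is
    -- substituted so that `simp` can evaluate the updates.
    rename_i inst
    obtain rfl : inst = instDecidableEqFin 3 := Subsingleton.elim _ _
    fin_cases i <;> simp [contactVolume, dFormAt_add_left, dFormAt_add_right] <;> ring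
  map_update_smul' m i t u := by
    rename_i inst
    obtain rfl : inst = instDecidableEqFin 3 := Subsingleton.elim _ _
    fin_cases i <;> simp [contactVolume, dFormAt_smul_left, dFormAt_smul_right] <;> ring
  map_eq_zero_of_eq' m i j h hij := by
    simp only [contactVolume]
    have hs := dFormAt_swap α p x
    have h0 := dFormAt_self α p x
    fin_cases i <;> fin_cases j <;> simp at hij h <;> rw [h] <;>
      simp [h0, hs (m 0) (m 1), hs (m 0) (m 2), hs (m 1) (m 2)]

/-- In dimension 3, an alternating 3-form vanishing on one basis is zero. -/
theorem contactVolume_ne_zero [FiniteDimensional ℝ E] (hE : Module.finrank ℝ E = 3)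
    [IsManifold I ∞ M] {α : ∀ p : M, TangentSpace I p →L[ℝ] ℝ} (hα : IsContactForm I α) (x : M)
    {m : Fin 3 → E} (hm : LinearIndependent ℝ m) :
    contactVolume I α x x (m 0) (m 1) (m 2) ≠ 0 := by
  intro h
  obtain ⟨u, v, w, huvw⟩ := hα.wedge_ne_zero x
  apply huvw
  let B : Module.Basis (Fin 3) ℝ E := basisOfLinearIndependentOfCardEqFinrank hm (by simp [hE])
  have hB : contactVolumeMap I α x x B = 0 := by
    rw [coe_basisOfLinearIndependentOfCardEqFinrank]; exact h
  have hz : contactVolumeMap I α x x = 0 := by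
    by_contra hne
    exact (AlternatingMap.map_basis_ne_zero_iff B _).2 hne hB
  exact DFunLike.congr_fun hz (![u, v, w] : Fin 3 → E)

theorem covector_ne_zero [IsManifold I ∞ M] {α : ∀ p : M, TangentSpace I p →L[ℝ] ℝ}
    (hα : IsContactForm I α) (x : M) : covector α x ≠ 0 := by
  intro h
  obtain ⟨u, v, w, huvw⟩ := hα.wedge_ne_zero x
  apply huvw
  have h' : ∀ u : TangentSpace I x, α x u = 0 := fun u ↦ DFunLike.congr_fun h u
  simp [h']

/-- Applying the hypothesis to `v` and `-v` shows that `g` vanishes on `ker f`. In fact `k < 0`, but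
only `k ≠ 0` is needed later. -/
theorem exists_smul_eq_of_pos_iff_neg {V : Type*} [AddCommGroup V] [Module ℝ V]
    {f g : V →ₗ[ℝ] ℝ} (hf : f ≠ 0) (h : ∀ v, 0 < f v ↔ g v < 0) :
    ∃ k : ℝ, k ≠ 0 ∧ ∀ v, g v = k * f v := by
  obtain ⟨w, hw⟩ : ∃ w, 0 < f w := by
    by_contra! hle
    apply hf
    ext v
    have h1 := hle v
    have h2 := hle (-v)
    rw [map_neg] at h2
    simp; linarith
  have hker : ∀ v, f v = 0 → g v = 0 := by
    intro v hv
    have h1 := (h v).not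
    have h2 := (h (-v)).not
    simp only [map_neg, hv] at h1 h2
    simp at h1 h2
    linarith
  have hgw := (h w).1 hw
  refine ⟨g w / f w, div_ne_zero hgw.ne hw.ne', fun v ↦ ?_⟩
  -- This combination lies in `ker f`.
  have := hker (f w • v - f v • w) (by simp; ring)
  simp at this
  field_simp
  linarith

theorem IsRealStructure.exists_factor [IsManifold I ∞ M]
    {α : ∀ p : M, TangentSpace I p →L[ℝ] ℝ} (hα : IsContactForm I α) {c : M → M}
    (hc : IsRealStructure I α c) :
    ∃ k : M → ℝ, (∀ z, k z ≠ 0) ∧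
      ∀ (z : M) (w : E), covector α (c z) (selfDeriv I c z w) = k z * covector α z w := by
  have h : ∀ z : M, ∃ k : ℝ, k ≠ 0 ∧
      ∀ w : E, covector α (c z) (selfDeriv I c z w) = k * covector α z w := fun z ↦
    exists_smul_eq_of_pos_iff_neg
      (f := ((covector α z : E →L[ℝ] ℝ) : E →ₗ[ℝ] ℝ))
      (g := ((covector α (c z) ∘L selfDeriv I c z : E →L[ℝ] ℝ) : E →ₗ[ℝ] ℝ))
      (fun h0 ↦ covector_ne_zero hα z (by ext w; exact DFunLike.congr_fun h0 w))
      (fun v ↦ hc.anti z v)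
  choose k hk hk' using h
  exact ⟨k, hk, hk'⟩

/-- `kα ∧ d(kα) = k² α ∧ dα`, as the term `kα ∧ dk ∧ α` vanishes. -/
theorem contactVolume_pullback [IsManifold I ∞ M]
    {α : ∀ p : M, TangentSpace I p →L[ℝ] ℝ} (hα : IsContactForm I α)
    {g : M → M} (hg : ContMDiff I I ∞ g) {k : M → ℝ}
    (hk : ∀ (z : M) (w : E), covector α (g z) (selfDeriv I g z w) = k z * covector α z w)
    {p q z : M} (hz : z ∈ (extChartAt I p).source) (hgz : g z ∈ (extChartAt I q).source)
    (u v w : E) :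
    contactVolume I α q (g z) (selfDeriv I g z u) (selfDeriv I g z v) (selfDeriv I g z w) =
      k z ^ 2 * contactVolume I α p z u v w := by
  have hk' := (mdifferentiableAt_factor hα.smooth hg hk (covector_ne_zero hα z)).hasMFDerivAt
  simp only [contactVolume, dFormAt_pullback hα.smooth hg hk hz hgz hk', hk]
  ring

/-- The push-forward `c_* Y` of a vector field by an involution `c`. -/
def pushforward (c : M → M) (Y : ∀ p : M, TangentSpace I p) : ∀ p : M, TangentSpace I p :=
  fun q ↦ selfDeriv I c (c q) (Y (c q))

theorem pushforward_apply_map {c : M → M} (hc : Function.Involutive c)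
    (Y : ∀ p : M, TangentSpace I p) (p : M) :
    pushforward c Y (c p) = mfderiv I I c p (Y p) := by
  have key : ∀ p' : M, p' = p →
      selfDeriv I c p' (Y p' : E) = selfDeriv I c p (Y p : E) := by rintro _ rfl; rfl
  exact key _ (hc p)

theorem selfDeriv_involutive {c : M → M} (hs : MDifferentiable I I c)
    (hc : Function.Involutive c) (p : M) (v : E) :
    selfDeriv I c (c p) (selfDeriv I c p v) = v := by
  have h := mfderiv_comp p (hs (c p)) (hs p)
  rw [hc.comp_self] at h
  have h2 : (ContinuousLinearMap.id ℝ E : E →L[ℝ] E) =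
    selfDeriv I c (c p) ∘L selfDeriv I c p := (mfderiv_id (I := I) (x := p)).symm.trans h
  exact (DFunLike.congr_fun h2 v).symm

theorem contMDiffOn_pushforward [IsManifold I ∞ M] {c : M → M} (hs : ContMDiff I I ∞ c)
    (hc : Function.Involutive c) {Y : ∀ p : M, TangentSpace I p} {U : Set M}
    (hY : ContMDiffOn I I.tangent ∞ (fun p ↦ (⟨p, Y p⟩ : TangentBundle I M)) U) :
    ContMDiffOn I I.tangent ∞ (fun p ↦ (⟨p, pushforward c Y p⟩ : TangentBundle I M))
      (c ⁻¹' U) := by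
  have h := (hs.contMDiff_tangentMap (m := ∞) (by simp)).comp_contMDiffOn
    (hY.comp hs.contMDiffOn (subset_refl (c ⁻¹' U)))
  refine h.congr fun q _ ↦ ?_
  have key : ∀ (q' : M) (w : E), q' = q →
      (⟨q, w⟩ : TangentBundle I M) = ⟨q', w⟩ := by rintro _ _ rfl; rfl
  exact key _ _ (hc q)

theorem mdifferentiableAt_pairing [IsManifold I ∞ M] {α : ∀ p : M, TangentSpace I p →L[ℝ] ℝ}
    (hα : IsSmoothOneForm I α) {Y : ∀ p : M, TangentSpace I p} {p : M}
    (hY : ContMDiffAt I I.tangent ∞ (fun p ↦ (⟨p, Y p⟩ : TangentBundle I M)) p) :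
    MDifferentiableAt I 𝓘(ℝ, ℝ) (fun q ↦ α q (Y q)) p := by
  have h := ContMDiffAt.clm_bundle_apply (F₁ := E) (F₂ := ℝ) (E₂ := Bundle.Trivial M ℝ)
    (b := id) (hα p) hY
  have h2 := (Bundle.contMDiffAt_totalSpace.1 h).2
  exact ContMDiffAt.mdifferentiableAt h2 (by simp)

theorem lieDerivForm_pushforward [IsManifold I ∞ M]
    {α : ∀ p : M, TangentSpace I p →L[ℝ] ℝ} (hα : IsContactForm I α)
    {c : M → M} (hs : ContMDiff I I ∞ c) (hc : Function.Involutive c) {k : M → ℝ}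
    (hk0 : ∀ z, k z ≠ 0)
    (hk : ∀ (z : M) (w : E), covector α (c z) (selfDeriv I c z w) = k z * covector α z w)
    {Y : ∀ p : M, TangentSpace I p} {q : M}
    (hY : ContMDiffAt I I.tangent ∞ (fun p ↦ (⟨p, Y p⟩ : TangentBundle I M)) (c q))
    {μ : ℝ} (hμ : ∀ v, lieDerivForm I Y α (c q) v = μ * α (c q) v) :
    ∃ μ' : ℝ, ∀ v, lieDerivForm I (pushforward c Y) α q v = μ' * α q v := by
  obtain ⟨k', hk'⟩ : ∃ k' : E →L[ℝ] ℝ, HasMFDerivAt I 𝓘(ℝ, ℝ) k (c q) k' :=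
    ⟨_, (mdifferentiableAt_factor hα.smooth hs hk (covector_ne_zero hα (c q))).hasMFDerivAt⟩
  obtain ⟨f', hf'⟩ : ∃ f' : E →L[ℝ] ℝ,
      HasMFDerivAt I 𝓘(ℝ, ℝ) (fun q ↦ α q (Y q)) (c q) f' :=
    ⟨_, (mdifferentiableAt_pairing hα.smooth hY).hasMFDerivAt⟩
  have hpair : (fun q ↦ α q (pushforward c Y q)) = (fun p ↦ k p * α p (Y p)) ∘ c := by
    ext z
    have := hk (c z) (Y (c z))
    rw [hc z] at this
    exact this
  have hd := HasMFDerivAt.comp q (hk'.mul hf')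
    (hs.mdifferentiableAt (x := q) (by simp)).hasMFDerivAt
  rw [show (k * fun q ↦ α q (Y q)) ∘ c = fun q ↦ α q (pushforward c Y q) from hpair.symm] at hd
  -- Naming the vector in the model space frees it from the fibre over `c q`, so that `c (c q) = q`
  -- can be rewritten.
  obtain ⟨y, hy⟩ : ∃ y : E, y = Y (c q) := ⟨_, rfl⟩
  have key : ∀ v : E, ∃ w : E, v = selfDeriv I c (c q) w ∧
      (lieDerivForm I Y α (c q) w : ℝ) = dFormAt I α (c q) (c q) y w + f' w ∧
      (lieDerivForm I (pushforward c Y) α q v : ℝ) =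
        dFormAt I α q q (selfDeriv I c (c q) y) v + (k (c q) * f' w + covector α (c q) y * k' w) := by
    intro v
    refine ⟨selfDeriv I c q v,
      (selfDeriv_involutive (hs.mdifferentiable (by simp)) hc q v).symm, ?_, ?_⟩
    · have h := DFunLike.congr_fun hf'.mfderiv (selfDeriv I c q v)
      subst hy
      exact congrArg (dFormAt I α (c q) (c q) (Y (c q)) (selfDeriv I c q v) + ·) h
    · have h := DFunLike.congr_fun hd.mfderiv v
      subst hy
      exact congrArg (dFormAt I α q q (selfDeriv I c (c q) (Y (c q))) v + ·) h
  -- With `v = dc(w)`, the terms `k'(w) α(y)` from `dα` and from the derivative of `k α(Y)` cancel.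
  -- What remains is `(k'(y) + kμ) α(w)`, and `α(v) = k α(w)`.
  refine ⟨(k' y + k (c q) * μ) / k (c q), fun v ↦ ?_⟩
  obtain ⟨w, hvw, h1, h2⟩ := key v
  have h3 : dFormAt I α (c q) (c q) y w + f' w = μ * covector α (c q) w := h1.symm.trans (hμ w)
  have hform := dFormAt_pullback hα.smooth hs hk (p := c q) (q := q) (z := c q)
    (mem_extChartAt_source (c q)) (by rw [hc q]; exact mem_extChartAt_source q) hk' y w
  have hcv := hk (c q) w
  rw [← hvw, hc q] at hform hcv
  refine h2.trans ?_
  change _ = _ * covector α q v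
  rw [hform, hcv, ← mul_assoc, div_mul_cancel₀ _ (hk0 (c q))]
  linear_combination (k (c q)) * h3

theorem lieDerivForm_add_smul [IsManifold I ∞ M]
    {α : ∀ p : M, TangentSpace I p →L[ℝ] ℝ} (hα : IsSmoothOneForm I α)
    {Y Z : ∀ p : M, TangentSpace I p} {p : M}
    (hY : ContMDiffAt I I.tangent ∞ (fun p ↦ (⟨p, Y p⟩ : TangentBundle I M)) p)
    (hZ : ContMDiffAt I I.tangent ∞ (fun p ↦ (⟨p, Z p⟩ : TangentBundle I M)) p)
    (t : ℝ) (v : TangentSpace I p) :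
    lieDerivForm I (fun q ↦ Y q + t • Z q) α p v =
      lieDerivForm I Y α p v + t * lieDerivForm I Z α p v := by
  have h1 := (mdifferentiableAt_pairing hα hY).hasMFDerivAt
  have h2 := (mdifferentiableAt_pairing hα hZ).hasMFDerivAt
  have h3 := (h1.add (h2.const_smul t)).mfderiv
  have h4 : (show ℝ from
      mfderiv I 𝓘(ℝ, ℝ) (fun q : M ↦ α q (Y q + t • Z q)) p v) =
      (show ℝ from mfderiv I 𝓘(ℝ, ℝ) (fun q : M ↦ α q (Y q)) p v) +
      t * (show ℝ from mfderiv I 𝓘(ℝ, ℝ) (fun q : M ↦ α q (Z q)) p v) := by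
    have : (fun q : M ↦ α q (Y q + t • Z q)) =
        (fun q ↦ α q (Y q)) + t • (fun q ↦ α q (Z q)) := by
      ext q; simp
    rw [this]
    exact DFunLike.congr_fun h3 v
  have h5 : dForm I α p (Y p + t • Z p) v = dForm I α p (Y p) v + t * dForm I α p (Z p) v :=
    (dFormAt_add_left α p p (Y p) (t • Z p : E) v).trans
      (congrArg _ (dFormAt_smul_left α p p t (Z p) v))
  unfold lieDerivForm
  rw [h4, h5]
  ring

/-- The field `Y + t c_* Y` is contact where `Y` and `c_* Y` are defined. -/
theorem isContactVectorFieldOn_add_pushforward [IsManifold I ∞ M]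
    {α : ∀ p : M, TangentSpace I p →L[ℝ] ℝ} (hα : IsContactForm I α) {c : M → M}
    (hc : IsRealStructure I α c) {Y : ∀ p : M, TangentSpace I p} {U : Set M}
    (hY : IsContactVectorFieldOn I α Y U) (t : ℝ) :
    IsContactVectorFieldOn I α (fun p ↦ Y p + t • pushforward c Y p) (U ∩ c ⁻¹' U) := by
  obtain ⟨k, hk0, hk⟩ := hc.exists_factor hα
  have hopen : IsOpen (c ⁻¹' U) := hY.isOpen.preimage hc.smooth.continuous
  have hZ := contMDiffOn_pushforward hc.smooth hc.involutive hY.smooth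
  obtain ⟨μ, hμ⟩ := hY.contact
  have hμ' : ∀ q : M, ∃ μ' : ℝ, q ∈ c ⁻¹' U →
      ∀ v, lieDerivForm I (pushforward c Y) α q v = μ' * α q v := by
    intro q
    by_cases hq : q ∈ c ⁻¹' U
    · obtain ⟨μ', h⟩ := lieDerivForm_pushforward hα hc.smooth hc.involutive hk0 hk
        (hY.smooth.contMDiffAt (hY.isOpen.mem_nhds hq)) (hμ _ hq)
      exact ⟨μ', fun _ ↦ h⟩
    · exact ⟨0, fun h ↦ absurd h hq⟩
  choose μ' hμ' using hμ'
  refine ⟨hY.isOpen.inter hopen, ?_, fun p ↦ μ p + t * μ' p, fun p hp v ↦ ?_⟩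
  · exact (hY.smooth.mono inter_subset_left).add_section
      ((hZ.mono inter_subset_right).const_smul_section)
  · rw [lieDerivForm_add_smul hα.smooth (hY.smooth.contMDiffAt (hY.isOpen.mem_nhds hp.1))
      (hZ.contMDiffAt (hopen.mem_nhds hp.2)), hμ p hp.1, hμ' p hp.2]
    ring

end ContactFields

/-! ### Continuity of `α ∧ dα` on continuous vector fields along a map. -/

section Continuity

variable {E : Type*} [NormedAddCommGroup E] [NormedSpace ℝ E]
  {H : Type*} [TopologicalSpace H] {I : ModelWithCorners ℝ E H}
  {M : Type*} [TopologicalSpace M] [ChartedSpace H M]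
  {T : Type*} [TopologicalSpace T]

theorem continuousWithinAt_chartDeriv [IsManifold I ∞ M] {b : T → M} {u : T → E} {V : Set T}
    {t₀ : T} (ht₀ : t₀ ∈ V)
    (hu : ContinuousWithinAt (fun t ↦ (⟨b t, u t⟩ : TangentBundle I M)) V t₀) :
    ContinuousWithinAt (fun t ↦ chartDeriv I (b t₀) (b t) (u t)) V t₀ := by
  rw [FiberBundle.continuousWithinAt_totalSpace] at hu
  refine hu.2.congr_of_eventuallyEq_of_mem ?_ ht₀
  have h := hu.1.eventually ((chartAt H (b t₀)).open_source.mem_nhds (mem_chart_source H (b t₀)))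
  filter_upwards [h] with t ht
  have h1 := DFunLike.congr_fun
    (TangentBundle.continuousLinearMapAt_trivializationAt (I := I) ht) (u t)
  have hb : b t ∈ (trivializationAt E (TangentSpace I) (b t₀)).baseSet := ht
  have h2 := (trivializationAt E (TangentSpace I) (b t₀)).coe_linearMapAt_of_mem (R := ℝ) hb
  exact h1.symm.trans (congrFun h2 (u t))

theorem continuousWithinAt_extDerivWithin_chartForm [IsManifold I ∞ M]
    {α : ∀ p : M, TangentSpace I p →L[ℝ] ℝ} (hα : IsSmoothOneForm I α) {p z : M}
    (hz : z ∈ (extChartAt I p).source) :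
    ContinuousWithinAt (extDerivWithin (chartForm I α p) (range I)) (range I)
      (extChartAt I p z) := by
  have hx : extChartAt I p z ∈ range I := extChartAt_target_subset_range p
    ((extChartAt I p).map_source hz)
  have h := ((contDiffWithinAt_chartForm hα hz).fderivWithin_right (m := 0) I.uniqueDiffOn
    (by norm_cast) hx).continuousWithinAt
  exact (ContinuousAlternatingMap.alternatizeUncurryFinCLM ℝ E ℝ
    (n := 1)).continuous.continuousAt.comp_continuousWithinAt h

theorem continuousWithinAt_contactVolume [IsManifold I ∞ M]
    {α : ∀ p : M, TangentSpace I p →L[ℝ] ℝ} (hα : IsSmoothOneForm I α)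
    {b : T → M} {u v w : T → E} {V : Set T} {t₀ : T} (ht₀ : t₀ ∈ V)
    (hu : ContinuousWithinAt (fun t ↦ (⟨b t, u t⟩ : TangentBundle I M)) V t₀)
    (hv : ContinuousWithinAt (fun t ↦ (⟨b t, v t⟩ : TangentBundle I M)) V t₀)
    (hw : ContinuousWithinAt (fun t ↦ (⟨b t, w t⟩ : TangentBundle I M)) V t₀) :
    ContinuousWithinAt (fun t ↦ contactVolume I α (b t) (b t) (u t) (v t) (w t)) V t₀ := by
  have hb : ContinuousWithinAt b V t₀ := by
    rw [FiberBundle.continuousWithinAt_totalSpace] at hu; exact hu.1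
  have hz := mem_extChartAt_source (I := I) (b t₀)
  have hev := hb.eventually ((isOpen_extChartAt_source (I := I) (b t₀)).mem_nhds hz)
  have hφ : ContinuousWithinAt (fun t ↦ extChartAt I (b t₀) (b t)) V t₀ :=
    (continuousAt_extChartAt (I := I) (b t₀)).comp_continuousWithinAt hb
  have hA : ContinuousWithinAt (fun t ↦ chartForm I α (b t₀) (extChartAt I (b t₀) (b t))) V t₀ :=
    (contDiffWithinAt_chartForm hα hz).continuousWithinAt.comp
      (f := fun t ↦ extChartAt I (b t₀) (b t)) hφ (fun t _ ↦ mem_range_self _)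
  have hdA : ContinuousWithinAt (fun t ↦ extDerivWithin (chartForm I α (b t₀)) (range I)
      (extChartAt I (b t₀) (b t))) V t₀ :=
    (continuousWithinAt_extDerivWithin_chartForm hα hz).comp
      (f := fun t ↦ extChartAt I (b t₀) (b t)) hφ (fun t _ ↦ mem_range_self _)
  have hcov : ∀ a : T → E,
      ContinuousWithinAt (fun t ↦ (⟨b t, a t⟩ : TangentBundle I M)) V t₀ →
      ContinuousWithinAt (fun t ↦ covector α (b t) (a t)) V t₀ := by
    intro a ha
    have h1 := continuousWithinAt_chartDeriv ht₀ ha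
    have h2 : ContinuousWithinAt (fun t ↦ chartForm I α (b t₀) (extChartAt I (b t₀) (b t))
        (fun _ ↦ chartDeriv I (b t₀) (b t) (a t))) V t₀ :=
      hA.eval (continuousWithinAt_pi.2 fun _ ↦ h1)
    refine h2.congr_of_eventuallyEq_of_mem ?_ ht₀
    filter_upwards [hev] with t ht
    exact (chartForm_chartDeriv_apply α ht (fun _ ↦ a t)).symm
  have hd : ∀ a a' : T → E,
      ContinuousWithinAt (fun t ↦ (⟨b t, a t⟩ : TangentBundle I M)) V t₀ →
      ContinuousWithinAt (fun t ↦ (⟨b t, a' t⟩ : TangentBundle I M)) V t₀ →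
      ContinuousWithinAt (fun t ↦ dFormAt I α (b t) (b t) (a t) (a' t)) V t₀ := by
    intro a a' ha ha'
    -- `dα` at `b t` is defined through a chart that moves with `t`. The chart is frozen at `b t₀`,
    -- which changes nothing by `dFormAt_eq_dFormAt`.
    have h2 : ContinuousWithinAt (fun t ↦ dFormAt I α (b t₀) (b t) (a t) (a' t)) V t₀ := by
      refine hdA.eval (continuousWithinAt_pi.2 fun i ↦ ?_)
      fin_cases i
      · exact continuousWithinAt_chartDeriv ht₀ ha
      · exact continuousWithinAt_chartDeriv ht₀ ha'
    refine h2.congr_of_eventuallyEq_of_mem ?_ ht₀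
    filter_upwards [hev] with t ht
    exact dFormAt_eq_dFormAt hα ht (mem_extChartAt_source _) _ _
  exact (((hcov u hu).mul (hd v w hv hw)).add ((hcov v hv).mul (hd w u hw hu))).add
    ((hcov w hw).mul (hd u v hu hv))

end Continuity

/-! ### Immersions have injective derivative. -/

section Surface

variable {E : Type*} [NormedAddCommGroup E] [NormedSpace ℝ E]
  {H : Type*} [TopologicalSpace H] {I : ModelWithCorners ℝ E H}
  {M : Type*} [TopologicalSpace M] [ChartedSpace H M]
  {F : Type*} [NormedAddCommGroup F] [NormedSpace ℝ F]
  {G : Type*} [TopologicalSpace G] {J : ModelWithCorners ℝ F G}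
  {N : Type*} [TopologicalSpace N] [ChartedSpace G N]

/-- In the immersion charts `ι` is `y ↦ (y, 0)` up to a linear equivalence, so the projection `L`
recovers the domain chart from `ι`. The injective derivative of that chart thus factors through the
derivative of `ι`. -/
theorem mfderiv_injective_of_isImmersionAt [IsManifold J ∞ N] [IsManifold I ∞ M] {ι : N → M}
    {x : N} (h : Manifold.IsImmersionAt J I ∞ ι x) : Function.Injective (mfderiv J I ι x) := by
  have hle : (1 : ℕ∞ω) ≤ ∞ := by norm_cast
  have hd := IsManifold.maximalAtlas_subset_of_le (I := J) (M := N) hle h.domChart_mem_maximalAtlas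
  have hc := IsManifold.maximalAtlas_subset_of_le (I := I) (M := M) hle h.codChart_mem_maximalAtlas
  have hι := h.contMDiffAt.mdifferentiableAt (by simp)
  have hx := h.mem_domChart_source
  have hιx := h.mem_codChart_source
  have hdm : h.domChart.MDifferentiable J J :=
    ⟨fun _ hy ↦ (mdifferentiableAt_of_mem_maximalAtlas hd hy).mdifferentiableWithinAt,
      fun _ hy ↦ (mdifferentiableAt_symm_of_mem_maximalAtlas hd hy).mdifferentiableWithinAt⟩
  let L : E →L[ℝ] F := (ContinuousLinearMap.fst ℝ F h.complement) ∘L (h.equiv.symm : E →L[ℝ] _)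
  have hφ : HasMFDerivAt J 𝓘(ℝ, F) (J ∘ h.domChart) x
      ((ContinuousLinearMap.id ℝ F).comp (mfderiv J J h.domChart x)) :=
    J.hasMFDerivAt.comp x (hdm.mdifferentiableAt hx).hasMFDerivAt
  have hψ := (I.hasMFDerivAt (x := h.codChart (ι x))).comp (ι x)
    (mdifferentiableAt_of_mem_maximalAtlas hc hιx).hasMFDerivAt
  have hLψ := (L.hasMFDerivAt.comp (ι x) hψ).comp x hι.hasMFDerivAt
  have heq : J ∘ h.domChart =ᶠ[𝓝 x] (L ∘ I ∘ h.codChart) ∘ ι := by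
    filter_upwards [h.domChart.open_source.mem_nhds hx] with y hy
    have hyt : (h.domChart.extend J) y ∈ (h.domChart.extend J).target :=
      (h.domChart.extend J).map_source (by simpa using hy)
    have hw := h.writtenInCharts hyt
    have hl := (h.domChart.extend_left_inv (I := J) hy)
    simp only [Function.comp_apply, hl] at hw
    have hw' : I (h.codChart (ι y)) = h.equiv (J (h.domChart y), 0) := by simpa using hw
    simp [L, hw']
  have hfin := hasMFDerivAt_unique hφ (hLψ.congr_of_eventuallyEq heq)
  intro v w hvw
  apply hdm.mfderiv_injective hx
  have e1 := DFunLike.congr_fun hfin v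
  have e2 := DFunLike.congr_fun hfin w
  refine e1.trans (Eq.trans ?_ e2.symm)
  exact congrArg (fun z ↦ (L.comp _ : TangentSpace I (ι x) →L[ℝ] F) z) hvw

end Surface

/-! ### Equivariance of the averaged field and invariance of its tangency set. -/

section Equivariance

variable {E : Type*} [NormedAddCommGroup E] [NormedSpace ℝ E]
  {H : Type*} [TopologicalSpace H] {I : ModelWithCorners ℝ E H}
  {M : Type*} [TopologicalSpace M] [ChartedSpace H M] {N : Type*}

/-- `c_*` exchanges `Y` and `c_*Y`, and `ε² = 1`. -/
theorem map_add_pushforward {c : M → M} (hs : MDifferentiable I I c)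
    (hc : Function.Involutive c) (Y : ∀ p : M, TangentSpace I p) {ε : ℝ} (hε : ε * ε = 1) (p : M) :
    mfderiv I I c p (Y p + ε • pushforward c Y p) =
      ε • (Y (c p) + ε • pushforward c Y (c p)) := by
  have h1 : mfderiv I I c p (pushforward c Y p) = Y (c p) := by
    have key : ∀ p' : M, p' = p → selfDeriv I c p' (pushforward c Y p) =
      selfDeriv I c p (pushforward c Y p) := by rintro _ rfl; rfl
    have := selfDeriv_involutive hs hc (c p) (Y (c p))
    exact (key _ (hc p)).symm.trans this
  rw [map_add, map_smul, h1, pushforward_apply_map hc, smul_add, smul_smul, hε, one_smul,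
    add_comm]

theorem IsRealStructure.map_eq_zero {α : ∀ p : M, TangentSpace I p →L[ℝ] ℝ} {c : M → M}
    (hc : IsRealStructure I α c) (p : M) (v : TangentSpace I p) (hv : α p v = 0) :
    α (c p) (mfderiv I I c p v) = 0 := by
  have h1 := (hc.anti p v).not
  have h2 := (hc.anti p (-v)).not
  simp only [map_neg, hv] at h1 h2
  simp at h1 h2
  linarith

theorem image_tangencySet {α : ∀ p : M, TangentSpace I p →L[ℝ] ℝ} {c : M → M}
    (hc : IsRealStructure I α c) {ι : N → M} (hS : c '' range ι = range ι)
    {X : ∀ p : M, TangentSpace I p} {ε : ℝ} (hε : ε ≠ 0)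
    (hX : ∀ p, mfderiv I I c p (X p) = ε • X (c p)) :
    c '' tangencySet I α ι X = tangencySet I α ι X := by
  have hsub : ∀ p ∈ tangencySet I α ι X, c p ∈ tangencySet I α ι X := by
    rintro p ⟨hp, hp0⟩
    refine ⟨hS ▸ mem_image_of_mem c hp, ?_⟩
    have := hc.map_eq_zero p (X p) hp0
    rw [hX, map_smul, smul_eq_mul] at this
    exact (mul_eq_zero.1 this).resolve_left hε
  ext p
  constructor
  · rintro ⟨q, hq, rfl⟩
    exact hsub q hq
  · intro hp
    exact ⟨c p, hsub p hp, hc.involutive p⟩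

end Equivariance

/-! ### Sides of the surface, transversality of the average, and conclusion. -/

section Sides

variable {E : Type*} [NormedAddCommGroup E] [NormedSpace ℝ E]
  {H : Type*} [TopologicalSpace H] {I : ModelWithCorners ℝ E H}
  {M : Type*} [TopologicalSpace M] [ChartedSpace H M]
  {F : Type*} [NormedAddCommGroup F] [NormedSpace ℝ F]
  {G : Type*} [TopologicalSpace G] {J : ModelWithCorners ℝ F G}
  {N : Type*} [TopologicalSpace N] [ChartedSpace G N]

/-- The derivative at `x` of a map between manifolds, as a map of the model spaces. -/
def modelDeriv (J : ModelWithCorners ℝ F G) (I : ModelWithCorners ℝ E H) (ι : N → M) (x : N) :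
    F →L[ℝ] E := mfderiv J I ι x

/-- The area form on `N` obtained by contracting `α ∧ dα` with `Y` and pulling back by `ι`. -/
def contractedVolume (J : ModelWithCorners ℝ F G) (I : ModelWithCorners ℝ E H)
    (α : ∀ p : M, TangentSpace I p →L[ℝ] ℝ) (Y : ∀ p : M, TangentSpace I p)
    (ι : N → M) (x : N) : F [⋀^Fin 2]→ₗ[ℝ] ℝ :=
  ((contactVolumeMap I α (ι x) (ι x)).curryLeft (Y (ι x) : E)).compLinearMap
    (modelDeriv J I ι x : F →ₗ[ℝ] E)

theorem IsPositiveFrame.exists_basis {x : N} {o : Orientation ℝ (TangentSpace J x) (Fin 2)}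
    {a b : F} (h : IsPositiveFrame J o a b) :
    ∃ B : Module.Basis (Fin 2) ℝ F, B.orientation = o ∧ (B : Fin 2 → F) = ![a, b] := by
  obtain ⟨B, hB, h0, h1⟩ := h
  exact ⟨B, hB, by ext i; fin_cases i; exacts [h0, h1]⟩

/-- By transversality, `Y` and the image of a basis of the tangent plane are linearly independent.
-/
theorem contractedVolume_ne_zero [FiniteDimensional ℝ E] (hE : Module.finrank ℝ E = 3)
    [IsManifold I ∞ M] {α : ∀ p : M, TangentSpace I p →L[ℝ] ℝ} (hα : IsContactForm I α)
    {Y : ∀ p : M, TangentSpace I p} {ι : N → M} {x : N}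
    (hinj : Function.Injective (mfderiv J I ι x)) (hY : Y (ι x) ∉ range (mfderiv J I ι x))
    (B : Module.Basis (Fin 2) ℝ F) : contractedVolume J I α Y ι x B ≠ 0 := by
  have hli : LinearIndependent ℝ (modelDeriv J I ι x ∘ B) :=
    B.linearIndependent.map' (modelDeriv J I ι x : F →ₗ[ℝ] E) (LinearMap.ker_eq_bot.2 hinj)
  have hY' : (Y (ι x) : E) ∉ Submodule.span ℝ (range (modelDeriv J I ι x ∘ B)) := by
    intro h
    have hle : Submodule.span ℝ (range (modelDeriv J I ι x ∘ B)) ≤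
        LinearMap.range (modelDeriv J I ι x : F →ₗ[ℝ] E) := by
      rw [Submodule.span_le]
      rintro _ ⟨i, rfl⟩
      exact ⟨B i, rfl⟩
    exact hY (hle h)
  exact contactVolume_ne_zero hE hα (ι x)
    (linearIndependent_finCons.2 ⟨hli, hY'⟩)

/-- Two positive frames differ by a positive determinant, so the sign can be tested on any one of
them, in particular on a continuous local frame. -/
theorem contractedVolume_pos_iff {α : ∀ p : M, TangentSpace I p →L[ℝ] ℝ}
    {Y : ∀ p : M, TangentSpace I p} {ι : N → M} {x : N}
    {o : Orientation ℝ (TangentSpace J x) (Fin 2)} {a b a' b' : F}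
    (h : IsPositiveFrame J o a b) (h' : IsPositiveFrame J o a' b') (σ : ℝ) :
    0 < σ * contractedVolume J I α Y ι x ![a, b] ↔
      0 < σ * contractedVolume J I α Y ι x ![a', b'] := by
  obtain ⟨B, hB, e⟩ := h.exists_basis
  obtain ⟨B', hB', e'⟩ := h'.exists_basis
  rw [← e, ← e']
  have hdet : 0 < B.det B' := (Module.Basis.orientation_eq_iff_det_pos B B').1 (hB.trans hB'.symm)
  have hη := DFunLike.congr_fun
    (AlternatingMap.eq_smul_basis_det B (contractedVolume J I α Y ι x)) (B' : Fin 2 → F)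
  rw [hη, AlternatingMap.smul_apply, smul_eq_mul, ← mul_assoc, mul_pos_iff_of_pos_right hdet]

theorem SurfaceOrientation.exists_isPositiveFrame [IsManifold J ∞ N]
    (o : SurfaceOrientation J (N := N)) (x : N) : ∃ a b, IsPositiveFrame J (o.orient x) a b := by
  obtain ⟨V, hV, a, b, -, -, h⟩ := o.continuous x
  exact ⟨_, _, h x (mem_of_mem_nhds hV)⟩

theorem isOpen_setOf_contractedVolume_pos [IsManifold I ∞ M] [IsManifold J ∞ N]
    {α : ∀ p : M, TangentSpace I p →L[ℝ] ℝ} (hα : IsSmoothOneForm I α)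
    {Y : ∀ p : M, TangentSpace I p} {ι : N → M} (hι : ContMDiff J I ∞ ι) {U : Set M}
    (hU : IsOpen U) (hιU : range ι ⊆ U)
    (hY : ContMDiffOn I I.tangent ∞ (fun p ↦ (⟨p, Y p⟩ : TangentBundle I M)) U)
    (o : SurfaceOrientation J (N := N)) (σ : ℝ) :
    IsOpen {x : N | ∀ a b : F, IsPositiveFrame J (o.orient x) a b →
      0 < σ * contractedVolume J I α Y ι x ![a, b]} := by
  rw [isOpen_iff_mem_nhds]
  intro x₀ hx₀
  obtain ⟨V, hV, a, b, ha, hb, h⟩ := o.continuous x₀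
  have hx₀V := mem_of_mem_nhds hV
  have htan := hι.continuous_tangentMap (by simp)
  have hc : ContinuousWithinAt (fun x ↦ contractedVolume J I α Y ι x ![a x, b x]) V x₀ := by
    refine continuousWithinAt_contactVolume hα hx₀V ?_ ?_ ?_
    · have h1 : ContinuousAt (fun p ↦ (⟨p, Y p⟩ : TangentBundle I M)) (ι x₀) :=
        hY.continuousOn.continuousAt (hU.mem_nhds (hιU (mem_range_self _)))
      exact h1.comp_continuousWithinAt (f := ι) hι.continuous.continuousWithinAt
    · exact htan.continuousAt.comp_continuousWithinAt (ha x₀ hx₀V)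
    · exact htan.continuousAt.comp_continuousWithinAt (hb x₀ hx₀V)
  have hpos := (continuousWithinAt_const.mul hc).eventually
    (lt_mem_nhds (hx₀ _ _ (h x₀ hx₀V)))
  rw [nhdsWithin_eq_nhds.2 hV] at hpos
  filter_upwards [hpos, hV] with x hx hxV a' b' hab'
  exact (contractedVolume_pos_iff (h x hxV) hab' σ).1 hx

/-- A vector field transverse to a connected oriented surface stays on one side of it. -/
theorem exists_side [FiniteDimensional ℝ E] (hE : Module.finrank ℝ E = 3)
    [IsManifold I ∞ M] [ConnectedSpace N] [IsManifold J ∞ N]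
    {α : ∀ p : M, TangentSpace I p →L[ℝ] ℝ} (hα : IsContactForm I α)
    {Y : ∀ p : M, TangentSpace I p} {ι : N → M} (hι : Manifold.IsSmoothEmbedding J I ∞ ι)
    {U : Set M} (hU : IsOpen U) (hιU : range ι ⊆ U)
    (hY : ContMDiffOn I I.tangent ∞ (fun p ↦ (⟨p, Y p⟩ : TangentBundle I M)) U)
    (htr : IsTransverse J I ι Y) (o : SurfaceOrientation J (N := N)) :
    ∃ σ : ℝ, ∀ (x : N) (a b : F), IsPositiveFrame J (o.orient x) a b →
      0 < σ * contractedVolume J I α Y ι x ![a, b] := by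
  have hopen := isOpen_setOf_contractedVolume_pos hα.smooth hι.contMDiff hU hιU hY o
  set P : ℝ → Set N := fun σ ↦ {x : N | ∀ a b : F, IsPositiveFrame J (o.orient x) a b →
      0 < σ * contractedVolume J I α Y ι x ![a, b]} with hP
  -- The area form never vanishes, so its positive and negative loci are complementary; both are
  -- open, hence clopen in the connected `N`.
  have hcompl : (P 1)ᶜ = P (-1) := by
    ext x
    obtain ⟨a, b, hab⟩ := o.exists_isPositiveFrame x
    have hne : contractedVolume J I α Y ι x ![a, b] ≠ 0 := by
      obtain ⟨B, -, e⟩ := hab.exists_basis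
      rw [← e]
      exact contractedVolume_ne_zero hE hα
        (mfderiv_injective_of_isImmersionAt (hι.isImmersion.isImmersionAt x)) (htr x) B
    have hmem : ∀ σ : ℝ, x ∈ P σ ↔ 0 < σ * contractedVolume J I α Y ι x ![a, b] := fun σ ↦
      ⟨fun h ↦ h a b hab, fun h a' b' hab' ↦ (contractedVolume_pos_iff hab hab' σ).1 h⟩
    rw [mem_compl_iff, hmem, hmem, one_mul, neg_one_mul, neg_pos, not_lt]
    exact ⟨fun h ↦ lt_of_le_of_ne h hne, le_of_lt⟩
  have hclopen : IsClopen (P 1) := ⟨⟨by rw [hcompl]; exact hopen (-1)⟩, hopen 1⟩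
  rcases isClopen_iff.1 hclopen with h | h
  · refine ⟨-1, fun x ↦ ?_⟩
    have : x ∈ P (-1) := by rw [← hcompl, h]; simp
    exact this
  · refine ⟨1, fun x ↦ ?_⟩
    have : x ∈ P 1 := by rw [h]; simp
    exact this

theorem contactVolume_add_left (α : ∀ p : M, TangentSpace I p →L[ℝ] ℝ) (p x : M)
    (u u' v w : E) : contactVolume I α p x (u + u') v w =
      contactVolume I α p x u v w + contactVolume I α p x u' v w := by
  simp only [contactVolume, map_add, dFormAt_add_left, dFormAt_add_right]; ring

theorem contactVolume_smul_left (α : ∀ p : M, TangentSpace I p →L[ℝ] ℝ) (p x : M) (t : ℝ)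
    (u v w : E) : contactVolume I α p x (t • u) v w = t * contactVolume I α p x u v w := by
  simp only [contactVolume, map_smul, smul_eq_mul, dFormAt_smul_left, dFormAt_smul_right]; ring

theorem contactVolume_swap (α : ∀ p : M, TangentSpace I p →L[ℝ] ℝ) (p x : M)
    (u v w : E) : contactVolume I α p x u w v = -contactVolume I α p x u v w := by
  simp only [contactVolume, dFormAt_swap α p x v w, dFormAt_swap α p x u v,
    dFormAt_swap α p x w u]; ring

theorem contactVolume_eq_zero_of_mem_range {α : ∀ p : M, TangentSpace I p →L[ℝ] ℝ} {p x : M}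
    {L : F →L[ℝ] E} {B : Module.Basis (Fin 2) ℝ F} {u : E} (hu : u ∈ range L) :
    contactVolume I α p x u (L (B 0)) (L (B 1)) = 0 := by
  obtain ⟨v, rfl⟩ := hu
  have hv := B.sum_repr v
  rw [Fin.sum_univ_two] at hv
  rw [← hv, map_add, map_smul, map_smul, contactVolume_add_left, contactVolume_smul_left,
    contactVolume_smul_left]
  simp only [contactVolume, dFormAt_self, dFormAt_swap α p x (L (B 0)) (L (B 1))]
  ring

/-- `c|_S` multiplies the orientation of `S = ι(N)` by the sign `ε`. -/
def HasOrientationSign [IsManifold J ∞ N] (I : ModelWithCorners ℝ E H)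
    (o : SurfaceOrientation J (N := N)) (ι : N → M) (c : M → M) (ε : ℝ) : Prop :=
  ∀ x y : N, c (ι x) = ι y → ∀ a b : TangentSpace J x, IsPositiveFrame J (o.orient x) a b →
    ∃ a' b' : TangentSpace J y,
      (ε = 1 ∧ IsPositiveFrame J (o.orient y) a' b' ∨
        ε = -1 ∧ IsPositiveFrame J (o.orient y) b' a') ∧
      tangentMap I I c (tangentMap J I ι ⟨x, a⟩) = tangentMap J I ι ⟨y, a'⟩ ∧
      tangentMap I I c (tangentMap J I ι ⟨x, b⟩) = tangentMap J I ι ⟨y, b'⟩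

/-- If `Y + ε c_*Y` were tangent to `S` at `ι y`, its contraction with `α ∧ dα` would vanish on the
tangent plane. Yet the contributions of `Y` and `ε c_*Y` are nonzero with the same sign. -/
theorem isTransverse_add_pushforward [FiniteDimensional ℝ E] (hE : Module.finrank ℝ E = 3)
    [IsManifold I ∞ M] [ConnectedSpace N] [IsManifold J ∞ N]
    {α : ∀ p : M, TangentSpace I p →L[ℝ] ℝ} (hα : IsContactForm I α)
    {c : M → M} (hc : IsRealStructure I α c) {o : SurfaceOrientation J (N := N)}
    {ι : N → M} (hι : Manifold.IsSmoothEmbedding J I ∞ ι)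
    {Y : ∀ p : M, TangentSpace I p} {U : Set M} (hY : IsTransverseContactField J I α ι Y U)
    {ε : ℝ} (hS : c '' range ι = range ι) (hε : HasOrientationSign I o ι c ε) :
    IsTransverse J I ι (fun p ↦ Y p + ε • pushforward c Y p) := by
  obtain ⟨k, hk0, hk⟩ := hc.exists_factor hα
  obtain ⟨σ, hσ⟩ := exists_side hE hα hι hY.2.1.isOpen hY.1 hY.2.1.smooth hY.2.2 o
  have hσ' : ∀ (x : N) (a b : F), IsPositiveFrame J (o.orient x) a b →
      0 < σ * contactVolume I α (ι x) (ι x) (Y (ι x)) (modelDeriv J I ι x a)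
        (modelDeriv J I ι x b) := hσ
  intro y hy
  obtain ⟨x, hxy⟩ : ∃ x, c (ι x) = ι y := by
    obtain ⟨_, ⟨x, rfl⟩, hx⟩ : ι y ∈ c '' range ι := by rw [hS]; exact mem_range_self y
    exact ⟨x, hx⟩
  obtain ⟨a, b, hab⟩ := o.exists_isPositiveFrame x
  obtain ⟨a', b', hab', ha, hb⟩ := hε x y hxy a b hab
  have ha' : selfDeriv I c (ι x) (modelDeriv J I ι x a) = modelDeriv J I ι y a' :=
    congrArg (fun t : TangentBundle I M ↦ (t.2 : E)) ha
  have hb' : selfDeriv I c (ι x) (modelDeriv J I ι x b) = modelDeriv J I ι y b' :=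
    congrArg (fun t : TangentBundle I M ↦ (t.2 : E)) hb
  obtain ⟨s, hs⟩ : ∃ s : E, s = Y (ι y) := ⟨_, rfl⟩
  obtain ⟨t, ht⟩ : ∃ t : E, t = pushforward c Y (ι y) := ⟨_, rfl⟩
  have hst : s + ε • t ∈ range (modelDeriv J I ι y) := by subst hs ht; exact hy
  have hσy : ∀ a b : F, IsPositiveFrame J (o.orient y) a b →
      0 < σ * contactVolume I α (ι y) (ι y) s (modelDeriv J I ι y a) (modelDeriv J I ι y b) := by
    subst hs; exact hσ' y
  have hpush : t = selfDeriv I c (ι x) (Y (ι x)) := by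
    rw [ht, ← hxy]
    exact pushforward_apply_map hc.involutive Y (ι x)
  have hx := hσ' x a b hab
  have hvol := contactVolume_pullback hα hc.smooth hk (mem_extChartAt_source (ι x))
    (mem_extChartAt_source (c (ι x))) (Y (ι x)) (modelDeriv J I ι x a) (modelDeriv J I ι x b)
  have hxy2 : contactVolume I α (c (ι x)) (c (ι x)) = contactVolume I α (ι y) (ι y) := by
    rw [hxy]
  rw [ha', hb', hxy2, ← hpush] at hvol
  have hk2 : 0 < k (ι x) ^ 2 := by have := hk0 (ι x); positivity
  have hsum : contactVolume I α (ι y) (ι y) (s + ε • t)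
      (modelDeriv J I ι y a') (modelDeriv J I ι y b') = 0 := by
    rcases hab' with ⟨-, h⟩ | ⟨-, h⟩ <;> obtain ⟨B, -, e⟩ := h.exists_basis
    · have h0 : B 0 = a' := congrFun e 0
      have h1 : B 1 = b' := congrFun e 1
      rw [← h0, ← h1]
      exact contactVolume_eq_zero_of_mem_range hst
    · have h0 : B 0 = b' := congrFun e 0
      have h1 : B 1 = a' := congrFun e 1
      rw [← h0, ← h1, contactVolume_swap, neg_eq_zero]
      exact contactVolume_eq_zero_of_mem_range hst
  -- The vanishing sum is now the volume of `(Y, a', b')` at `ι y` plus `ε k²` times that of `(Y, a,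
  -- b)` at `ι x`. After multiplication by `σ`, both terms are positive if `ε = 1` and both negative
  -- if `ε = -1`, where `(b', a')` is the positive frame.
  rw [contactVolume_add_left, contactVolume_smul_left, hvol] at hsum
  have hprod := mul_pos hk2 hx
  rcases hab' with ⟨rfl, h⟩ | ⟨rfl, h⟩
  · have := hσy a' b' h
    have : σ * (_ + _) = σ * 0 := congrArg (σ * ·) hsum
    nlinarith
  · have := hσy b' a' h
    rw [contactVolume_swap] at this
    have : σ * (_ + _) = σ * 0 := congrArg (σ * ·) hsum
    nlinarith

/-- A convex surface whose orientation is multiplied by `ε` under `c` has a transverse contact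
vector field multiplied by `ε` under `c`. -/
theorem exists_equivariant_field [FiniteDimensional ℝ E] (hE : Module.finrank ℝ E = 3)
    [IsManifold I ∞ M] [ConnectedSpace N] [IsManifold J ∞ N]
    {α : ∀ p : M, TangentSpace I p →L[ℝ] ℝ} (hα : IsContactForm I α)
    {c : M → M} (hc : IsRealStructure I α c) {o : SurfaceOrientation J (N := N)}
    {ι : N → M} (hι : Manifold.IsSmoothEmbedding J I ∞ ι) (hconvex : IsConvexSurface J I α ι)
    {ε : ℝ} (hε1 : ε * ε = 1) (hS : c '' range ι = range ι) (hε : HasOrientationSign I o ι c ε) :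
    ∃ (U : Set M) (X : ∀ p : M, TangentSpace I p),
      IsTransverseContactField J I α ι X U ∧ c '' U = U ∧
      (∀ p, mfderiv I I c p (X p) = ε • X (c p)) ∧
      ∃ Γ : Set M, Γ = tangencySet I α ι X ∧ IsDividingSet J I α ι Γ ∧ c '' Γ = Γ := by
  obtain ⟨U, Y, hY⟩ := hconvex
  have hX : ∀ p, mfderiv I I c p (Y p + ε • pushforward c Y p) =
      ε • (Y (c p) + ε • pushforward c Y (c p)) :=
    map_add_pushforward (hc.smooth.mdifferentiable (by simp)) hc.involutive Y hε1
  -- `c_*Y` is controlled only on `c ⁻¹' U`. The intersection with `U` is `c`-invariant and still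
  -- contains `S`.
  have hT : IsTransverseContactField J I α ι (fun p ↦ Y p + ε • pushforward c Y p)
      (U ∩ c ⁻¹' U) :=
    ⟨fun p hp ↦ ⟨hY.1 hp, hY.1 (hS ▸ mem_image_of_mem c hp)⟩,
      isContactVectorFieldOn_add_pushforward hα hc hY.2.1 ε,
      isTransverse_add_pushforward hE hα hc hι hY hS hε⟩
  have hU : ∀ p ∈ U ∩ c ⁻¹' U, c p ∈ U ∩ c ⁻¹' U := fun p hp ↦
    ⟨hp.2, by rw [mem_preimage, hc.involutive p]; exact hp.1⟩
  refine ⟨U ∩ c ⁻¹' U, fun p ↦ Y p + ε • pushforward c Y p, hT, ?_, hX, _, rfl, ⟨_, _, hT, rfl⟩,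
    image_tangencySet hc hS (left_ne_zero_of_mul_eq_one hε1) hX⟩
  ext p
  constructor
  · rintro ⟨q, hq, rfl⟩
    exact hU q hq
  · intro hp
    exact ⟨c p, hU p hp, hc.involutive p⟩

end Sides

end RealContact

end

open RealContact in
theorem theorem3p1
    -- the ambient 3-manifold (boundary allowed, depending on the model `I`)
    {E : Type*} [NormedAddCommGroup E] [NormedSpace ℝ E] [FiniteDimensional ℝ E]
    (hE : Module.finrank ℝ E = 3)
    {H : Type*} [TopologicalSpace H] (I : ModelWithCorners ℝ E H)
    {M : Type*} [TopologicalSpace M] [T2Space M] [SecondCountableTopology M]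
    [ChartedSpace H M] [IsManifold I ∞ M]
    -- the real contact structure `(ξ = ker α, c)`
    (α : ∀ p : M, TangentSpace I p →L[ℝ] ℝ) (hα : IsContactForm I α)
    (c : M → M) (hc : IsRealStructure I α c)
    -- the connected oriented embedded surface `S = ι(N)`
    {F : Type*} [NormedAddCommGroup F] [NormedSpace ℝ F] [FiniteDimensional ℝ F]
    (hF : Module.finrank ℝ F = 2)
    {G : Type*} [TopologicalSpace G] (J : ModelWithCorners ℝ F G)
    {N : Type*} [TopologicalSpace N] [ConnectedSpace N]
    [ChartedSpace G N] [IsManifold J ∞ N]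
    (o : SurfaceOrientation J (N := N))
    (ι : N → M) (hι : Manifold.IsSmoothEmbedding J I ∞ ι)
    (hconvex : IsConvexSurface J I α ι) :
    (IsSymmetricSurface J I o ι c →
      ∃ (U : Set M) (X : ∀ p : M, TangentSpace I p),
        IsTransverseContactField J I α ι X U ∧ IsSymmetricFieldOn I c X U ∧
        ∃ Γ : Set M, Γ = tangencySet I α ι X ∧ IsDividingSet J I α ι Γ ∧ c '' Γ = Γ) ∧
    (IsAntisymmetricSurface J I o ι c →
      ∃ (U : Set M) (X : ∀ p : M, TangentSpace I p),
        IsTransverseContactField J I α ι X U ∧ IsAntisymmetricFieldOn I c X U ∧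
        ∃ Γ : Set M, Γ = tangencySet I α ι X ∧ IsDividingSet J I α ι Γ ∧ c '' Γ = Γ) := by

  constructor
  · intro hS
    obtain ⟨U, X, hX, hU, hcX, hΓ⟩ := exists_equivariant_field hE hα hc (o := o) hι hconvex
      (ε := 1) (by norm_num) hS.1 fun x y hxy a b hab ↦ by
        obtain ⟨a', b', h, h'⟩ := hS.2 x y hxy a b hab
        exact ⟨a', b', .inl ⟨rfl, h⟩, h'⟩
    exact ⟨U, X, hX, ⟨hU, fun p _ ↦ (hcX p).trans (one_smul ℝ _)⟩, hΓ⟩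
  · intro hS
    obtain ⟨U, X, hX, hU, hcX, hΓ⟩ := exists_equivariant_field hE hα hc (o := o) hι hconvex
      (ε := -1) (by norm_num) hS.1 fun x y hxy a b hab ↦ by
        obtain ⟨a', b', h, h'⟩ := hS.2 x y hxy a b hab
        exact ⟨a', b', .inr ⟨rfl, h⟩, h'⟩
    exact ⟨U, X, hX, ⟨hU, fun p _ ↦ (hcX p).trans (by rw [neg_smul, one_smul])⟩, hΓ⟩
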